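/- **Notions.** An *Archimedean generator* is a continuous, non-increasing function $\psi:[0,\infty]\to[0,1]$ with $\psi(0)=1$, $\psi(\infty)=0$ that is strictly decreasing on $[0,\inf\{t:\psi(t)=0\}]$; put $\psi^-(s)=\inf\{t:\psi(t)=s\}$. A function $f$ is *completely monotone* (c.m.) if it is smooth on $(0,\infty)$ and $(-1)^n f^{(n)}(t)\ge 0$ for all $n\ge 0$, $t>0$. Let $\widetilde\Psi^2$ be the set of pairs $(\psi_1,\psi_2)$ of c.m. generators such that $(\psi_1^-\circ\psi_2)'$ is c.m. For a generator $\psi$ let $C_\psi(u_1,\dots,u_n)=\psi(\psi^-(u_1)+\dots+\psi^-(u_n))$, and for a bivariate copula $C$ let $\tau(C)=4\int_{[0,1]^2} C\,dC-1$. A *family* $a$ consists of a parameter range $\Theta_a\subseteq\mathbb R$ and of c.m. generators $\psi^{(a,\theta)}$, $\theta\in\Theta_a$. **Hierarchical functions.** Consider a rooted tree with leaves $1,\dots,d$ and forks $d+1,\dots,d+k$, rooted in $d+k$, in which every fork has at least two children, and let $\lambda$ label the forks with c.m. generators. For $u\in[0,1]^d$ put $x_v=u_v$ at every leaf $v$,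 and, at every fork $v$, let $x_v$ be the value of $C_{\lambda(v)}$ at the values $x_w$ of the children $w$ of $v$. Then $C_{(V,E,\lambda)}(u)=x_{d+k}$ defines a function $C_{(V,E,\lambda)}:[0,1]^d\to[0,1]$. **Algorithm 1 (structure).** Input: a symmetric real matrix $(\tau_{ij})_{1\le i,j\le d}$, $d\ge 2$ (for example, a sample Kendall correlation matrix). Start with $\mathcal I=\{1,\dots,d\}$ and $\downarrow(i)=\{i\}$ for $i\le d$. For $k=1,\dots,d-1$: choose $i<j$ in $\mathcal I$ that maximize the average of the $\tau_{pq}$ over $(p,q)\in\downarrow(i)\times\downarrow(j)$ (ties are broken arbitrarily); make $i,j$ the children of a new fork $d+k$; put $\downarrow(d+k)=\downarrow(i)\cup\downarrow(j)$; let $\hat\tau_{d+k}$ be that maximal average; and replace $\mathcal I$ by $(\mathcal I\cup\{d+k\})\setminus\{i,j\}$. Output: the tree $(\hat V,\hat E)$ and $(\hat\tau_v)_{v=d+1}^{2d-1}$. **Algorithm 2 (homogeneous estimation).** For every fork $v$ of $(\hat V,\hat E)$ put $\hat\theta_v=\tau_{(a)}^{-1}(\hat\tau_v)$, where $\tau_{(a)}^{-1}$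 is the inverse of $\tau_{(a)}$ on $\Theta_a$, and $\hat\lambda(v)=\psi^{(a,\hat\theta_v)}$. Output: $(\hat V,\hat E,\hat\lambda)$. **Theorem.** Let $a$ be a family and $\tau_{(a)}$ a real function such that 1. $\tau_{(a)}(\theta)=\tau(C_{\psi^{(a,\theta)}})$, with the bivariate copula $C_{\psi^{(a,\theta)}}$, for all $\theta\in\Theta_a$; 2. $\tau_{(a)}$ is strictly increasing on $\Theta_a$; 3. for all $\theta_1,\theta_2\in\Theta_a$: $(\psi^{(a,\theta_1)},\psi^{(a,\theta_2)})\in\widetilde\Psi^2$ if and only if $\theta_1\le\theta_2$. Let $(\hat V,\hat E,(\hat\tau_v)_{v=d+1}^{2d-1})$ be any output of Algorithm 1. If $\hat\tau_v\in\tau_{(a)}(\Theta_a)$ for all $v\in\{d+1,\dots,2d-1\}$, then the output $(\hat V,\hat E,\hat\lambda)$ of Algorithm 2 satisfies $\hat\theta_v\le\hat\theta_w$ for every fork $v$ and every child $w$ of $v$ that is a fork, and the function $C_{(\hat V,\hat E,\hat\lambda)}$ is well defined and is a $d$-copula. -/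

import Mathlib

open Set MeasureTheory
open scoped ENNReal ContDiff

/-! Archimedean generators -/

/-- An Archimedean generator `ψ : [0, ∞] → [0, 1]`. -/
structure IsGenerator (ψ : ℝ≥0∞ → ℝ) : Prop where
  mem_unit : ∀ t, ψ t ∈ Icc (0 : ℝ) 1
  continuous : Continuous ψ
  antitone : Antitone ψ
  map_zero : ψ 0 = 1
  map_top : ψ ⊤ = 0
  strictAntiOn : StrictAntiOn ψ (Icc 0 (sInf {t | ψ t = 0}))

/-- Complete monotonicity on `(0, ∞)`: `f` is smooth there and `(-1)^n f^(n) ≥ 0` for all `n`. -/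
def IsCompletelyMonotone (f : ℝ → ℝ) : Prop :=
  ContDiffOn ℝ ∞ f (Ioi 0) ∧ ∀ n : ℕ, ∀ t : ℝ, 0 < t → 0 ≤ (-1 : ℝ) ^ n * iteratedDeriv n f t

/-- A completely monotone Archimedean generator. -/
def IsCMGenerator (ψ : ℝ≥0∞ → ℝ) : Prop :=
  IsGenerator ψ ∧ IsCompletelyMonotone (fun t : ℝ => ψ (ENNReal.ofReal t))

/-- The generalized inverse `ψ⁻(s) = inf {t | ψ t = s}`, with values in `[0, ∞]`. -/
noncomputable def genInv (ψ : ℝ≥0∞ → ℝ) (s : ℝ) : ℝ≥0∞ := sInf {t | ψ t = s}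

/-- `ψ (∑ i ∈ s, ψ⁻(x i))`: the Archimedean copula of `ψ` at the coordinates of `x` indexed
by `s`. -/
noncomputable def archValue {ι : Type*} (ψ : ℝ≥0∞ → ℝ) (s : Finset ι) (x : ι → ℝ) : ℝ :=
  ψ (∑ i ∈ s, genInv ψ (x i))

/-- The `n`-dimensional Archimedean copula `C_ψ`. -/
noncomputable def archCopula (n : ℕ) (ψ : ℝ≥0∞ → ℝ) (u : Fin n → ℝ) : ℝ :=
  archValue ψ Finset.univ u

/-- The sufficient nesting condition for a parent generator `ψ₁` and a child generator `ψ₂`: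
both are completely monotone and `(ψ₁⁻¹ ∘ ψ₂)'` is completely monotone. -/
def SufficientNesting (ψ₁ ψ₂ : ℝ≥0∞ → ℝ) : Prop :=
  IsCMGenerator ψ₁ ∧ IsCMGenerator ψ₂ ∧
    DifferentiableOn ℝ (fun t : ℝ => (genInv ψ₁ (ψ₂ (ENNReal.ofReal t))).toReal) (Ioi 0) ∧
    IsCompletelyMonotone (deriv fun t : ℝ => (genInv ψ₁ (ψ₂ (ENNReal.ofReal t))).toReal)

/-- A one-parameter family of completely monotone Archimedean generators with parameter
range `Θ ⊆ ℝ`. -/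
structure ArchFamily where
  Θ : Set ℝ
  gen : ℝ → ℝ≥0∞ → ℝ
  isCMGenerator : ∀ θ ∈ Θ, IsCMGenerator (gen θ)

/-! Copulas and Kendall's tau -/

/-- `C` (its restriction to `[0,1]^n`) is an `n`-copula: it is grounded, has uniform margins, and
gives every box a nonnegative volume. -/
structure IsCopula {n : ℕ} (C : (Fin n → ℝ) → ℝ) : Prop where
  grounded : ∀ u ∈ Icc (0 : Fin n → ℝ) 1, (∃ i, u i = 0) → C u = 0
  margins : ∀ u ∈ Icc (0 : Fin n → ℝ) 1, ∀ i, (∀ j, j ≠ i → u j = 1) → C u = u i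
  increasing : ∀ a ∈ Icc (0 : Fin n → ℝ) 1, ∀ b ∈ Icc (0 : Fin n → ℝ) 1, a ≤ b →
    0 ≤ ∑ S : Finset (Fin n), (-1 : ℝ) ^ S.card * C (fun i => if i ∈ S then a i else b i)

open Classical in
/-- The probability measure whose distribution function on `[0,1]^n` is `C`; it is unique, and
it exists for every copula `C`. -/
noncomputable def copulaMeasure {n : ℕ} (C : (Fin n → ℝ) → ℝ) : Measure (Fin n → ℝ) :=
  if h : ∃ μ : Measure (Fin n → ℝ), IsProbabilityMeasure μ ∧
      ∀ u ∈ Icc (0 : Fin n → ℝ) 1, μ (Iic u) = ENNReal.ofReal (C u)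
  then h.choose else 0

/-- Kendall's tau of a bivariate copula, `4 ∫ C dC - 1`. -/
noncomputable def kendallTau (C : (Fin 2 → ℝ) → ℝ) : ℝ :=
  4 * (∫ u in Icc (0 : Fin 2 → ℝ) 1, C u ∂(copulaMeasure C)) - 1

/-! Hierarchical Archimedean copulas. Nodes are numbered from `0`: with `d` leaves and `k` forks,
the leaves are `0, …, d - 1`, the forks are `d, …, d + k - 1`, and the root is `d + k - 1`.
A rooted tree is given by the map `children` that sends a node to the set of its children. -/

/-- `children` describes a rooted tree with leaves `0, …, d - 1`, forks `d, …, d + k - 1`, and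
root `d + k - 1`, in which every fork has at least two children. -/
structure IsHACStructure (d k : ℕ) (children : ℕ → Finset ℕ) : Prop where
  child_lt : ∀ v < d + k, ∀ w ∈ children v, w < d + k
  leaf : ∀ v < d, children v = ∅
  fork : ∀ v, d ≤ v → v < d + k → 2 ≤ (children v).card
  root : ∀ v < d + k, d + k - 1 ∉ children v
  parent : ∀ w < d + k - 1, ∃! v, v < d + k ∧ w ∈ children v
  reachable : ∀ w < d + k, Relation.ReflTransGen (fun v v' => v' ∈ children v) (d + k - 1) w

/-- `x` is the vector of node values belonging to the argument `u`: a leaf carries its coordinate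
of `u`, and a fork carries the Archimedean copula of its label at the values of its children. -/
structure IsNodeValues (d k : ℕ) (children : ℕ → Finset ℕ) (lab : ℕ → ℝ≥0∞ → ℝ)
    (u : Fin d → ℝ) (x : ℕ → ℝ) : Prop where
  mem_unit : ∀ v < d + k, x v ∈ Icc (0 : ℝ) 1
  fork : ∀ v, d ≤ v → v < d + k → x v = archValue (lab v) (children v) x
  leaf : ∀ i : Fin d, x i = u i

/-- `C` is the function `C_(V, E, lab)` on `[0,1]^d`: the structure is a tree, the forks are labeled
with completely monotone generators, node values exist for every argument, and the value of `C`
is the value at the root. -/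
structure IsHACFunction (d k : ℕ) (children : ℕ → Finset ℕ) (lab : ℕ → ℝ≥0∞ → ℝ)
    (C : (Fin d → ℝ) → ℝ) : Prop where
  tree : IsHACStructure d k children
  label : ∀ v, d ≤ v → v < d + k → IsCMGenerator (lab v)
  exists_values : ∀ u ∈ Icc (0 : Fin d → ℝ) 1, ∃ x, IsNodeValues d k children lab u x
  eq_root : ∀ u ∈ Icc (0 : Fin d → ℝ) 1, ∀ x, IsNodeValues d k children lab u x →
    C u = x (d + k - 1)

/-! Structure estimation -/

/-- The average of the entries `T i j` over `(i, j) ∈ A × B`. -/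
noncomputable def blockAvg {d : ℕ} (T : Matrix (Fin d) (Fin d) ℝ) (A B : Finset (Fin d)) : ℝ :=
  (∑ p ∈ A ×ˢ B, T p.1 p.2) / ((A ×ˢ B).card : ℝ)

/-- The variables of the structure estimation algorithm. -/
structure ClusterState (d : ℕ) where
  /-- the nodes that are still to be joined -/
  active : Finset ℕ
  /-- the children of a node -/
  children : ℕ → Finset ℕ
  /-- the descendant leaves of a node -/
  leaves : ℕ → Finset (Fin d)
  /-- the estimate of Kendall's tau at a fork -/
  tauHat : ℕ → ℝ

/-- The initial state: every leaf is active, and there are no edges. -/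
def ClusterState.init (d : ℕ) : ClusterState d where
  active := Finset.range d
  children := fun _ => ∅
  leaves := fun v => Finset.univ.filter fun l : Fin d => (l : ℕ) = v
  tauHat := fun _ => 0

/-- Join the nodes `i` and `j` to the new fork `f`. -/
noncomputable def ClusterState.join {d : ℕ} (T : Matrix (Fin d) (Fin d) ℝ) (s : ClusterState d)
    (i j f : ℕ) : ClusterState d where
  active := insert f s.active \ {i, j}
  children := Function.update s.children f {i, j}
  leaves := Function.update s.leaves f (s.leaves i ∪ s.leaves j)
  tauHat := Function.update s.tauHat f (blockAvg T (s.leaves i) (s.leaves j))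

/-- `(i, j)` maximizes the average similarity among the pairs of active nodes `i < j`. -/
def ClusterState.IsArgmax {d : ℕ} (T : Matrix (Fin d) (Fin d) ℝ) (s : ClusterState d)
    (i j : ℕ) : Prop :=
  i ∈ s.active ∧ j ∈ s.active ∧ i < j ∧
    ∀ i' ∈ s.active, ∀ j' ∈ s.active, i' < j' →
      blockAvg T (s.leaves i') (s.leaves j') ≤ blockAvg T (s.leaves i) (s.leaves j)

/-- `StructureRun T k s`: the algorithm with input `T` can be in state `s` after `k` passes of its
loop. Ties in the argmax may be broken in any way. The pass after `k` passes creates the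
fork `d + k`. -/
inductive StructureRun {d : ℕ} (T : Matrix (Fin d) (Fin d) ℝ) : ℕ → ClusterState d → Prop
  | init : StructureRun T 0 (ClusterState.init d)
  | step (k : ℕ) (s : ClusterState d) (i j : ℕ) (hs : StructureRun T k s)
      (hij : s.IsArgmax T i j) : StructureRun T (k + 1) (s.join T i j (d + k))

/-- `s` holds an output of the structure estimation algorithm: `d - 1` passes have been made. -/
def IsStructureEstimate {d : ℕ} (T : Matrix (Fin d) (Fin d) ℝ) (s : ClusterState d) : Prop :=
  StructureRun T (d - 1) s

/-! Homogeneous estimation -/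

/-- The estimated parameter `τ_a⁻¹(τ̂_v)`, where `τ_a⁻¹` is the inverse of `τ_a` on the parameter
range. -/
noncomputable def thetaHat (F : ArchFamily) (τa : ℝ → ℝ) (tauHat : ℕ → ℝ) (v : ℕ) : ℝ :=
  Function.invFunOn τa F.Θ (tauHat v)

/-- The estimated labeling: the generator of the family with the estimated parameter. -/
noncomputable def labelHat (F : ArchFamily) (τa : ℝ → ℝ) (tauHat : ℕ → ℝ) (v : ℕ) :
    ℝ≥0∞ → ℝ :=
  F.gen (thetaHat F τa tauHat v)

/-!
Merging two clusters replaces averages by weighted means of averages that were already available,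
so the maximal average cannot increase from one pass to the next. Hence `τ̂`, and with it `θ̂`,
decreases in the order in which the forks are created, and a child is created before its parent.

For the copula property, call a function on a join-semilattice alternating if its first difference
in every direction is nonnegative and all its iterated differences alternate in sign. As in the
theorem of Choquet on capacities, a completely monotone function of an alternating function is
completely monotone, and a function whose derivative is completely monotone maps alternating
functions to alternating ones. The vertices of a box form a semilattice in which joins lower the
coordinates. On it `ψ⁻(u_i)` preserves joins and is therefore alternating; if `y` is the value at a
child `w` of `v`, then `ψ_v⁻(y) = (ψ_v⁻ ∘ ψ_w)(ψ_w⁻(y))` is alternating by the nesting condition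
and induction; and sums of alternating functions are alternating. So the value at the root is
completely monotone on the vertices, and the iterated difference over all coordinates is the volume
of the box. Boxes that touch the boundary of the cube at `0` are handled by continuity.
-/
open Filter
open scoped Topology

/-! Complete monotonicity and complete alternation on a join-semilattice -/

section RealAnalysis

theorem le_of_hasDerivAt_nonneg {f f' : ℝ → ℝ} {a b : ℝ} (hab : a ≤ b)
    (hf : ∀ t ∈ Icc a b, HasDerivAt f (f' t) t) (hf' : ∀ t ∈ Icc a b, 0 ≤ f' t) : f a ≤ f b := by
  have hmono : MonotoneOn f (Icc a b) := monotoneOn_of_hasDerivWithinAt_nonneg (convex_Icc a b)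
    (fun t ht => (hf t ht).continuousAt.continuousWithinAt)
    (fun t ht => (hf t (interior_subset ht)).hasDerivWithinAt)
    fun t ht => hf' t (interior_subset ht)
  exact hmono (left_mem_Icc.2 hab) (right_mem_Icc.2 hab) hab

theorem tendsto_apply_add_nhdsGT {f : ℝ → ℝ} (hf : ContinuousOn f (Ici 0)) {y : ℝ}
    (hy : 0 ≤ y) : Tendsto (fun ε => f (y + ε)) (𝓝[>] 0) (𝓝 (f y)) := by
  refine (hf y hy).tendsto.comp (tendsto_nhdsWithin_iff.2 ⟨?_, ?_⟩)
  · exact ((continuous_const_add y).tendsto' 0 y (add_zero y)).mono_left nhdsWithin_le_nhds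
  · filter_upwards [self_mem_nhdsWithin] with ε hε
    exact add_nonneg hy (le_of_lt hε)

end RealAnalysis

section Semilattice

variable {M : Type*} [SemilatticeSup M]

/-- Complete monotonicity of order `n` on a join-semilattice (Choquet): the iterated differences
`∇_{a₁} ⋯ ∇_{aₘ} f` with `m ≤ n` are nonnegative, where `(∇_a f) x = f x - f (x ⊔ a)`. -/
def IsCMOfOrder : ℕ → (M → ℝ) → Prop
  | 0, f => ∀ x, 0 ≤ f x
  | n + 1, f => (∀ x, 0 ≤ f x) ∧ ∀ a, IsCMOfOrder n fun x => f x - f (x ⊔ a)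

/-- Complete alternation on a join-semilattice: every difference `x ↦ g (x ⊔ a) - g x` is
completely monotone of every order. No sign is imposed on `g` itself. -/
def IsAlternating (g : M → ℝ) : Prop :=
  ∀ n a, IsCMOfOrder n fun x => g (x ⊔ a) - g x

namespace IsCMOfOrder

variable {n : ℕ} {f g : M → ℝ}

theorem nonneg (hf : IsCMOfOrder n f) (x : M) : 0 ≤ f x := by
  cases n with
  | zero => exact hf x
  | succ n => exact hf.1 x

theorem of_succ (hf : IsCMOfOrder (n + 1) f) : IsCMOfOrder n f := by
  induction n generalizing f with
  | zero => exact hf.1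
  | succ n ih => exact ⟨hf.1, fun a => ih (hf.2 a)⟩

theorem zero : IsCMOfOrder n fun _ : M => (0 : ℝ) := by
  induction n with
  | zero => exact fun _ => le_rfl
  | succ n ih => exact ⟨fun _ => le_rfl, fun _ => by simpa only [sub_zero] using ih⟩

theorem add (hf : IsCMOfOrder n f) (hg : IsCMOfOrder n g) :
    IsCMOfOrder n fun x => f x + g x := by
  induction n generalizing f g with
  | zero => exact fun x => add_nonneg (hf x) (hg x)
  | succ n ih =>
    refine ⟨fun x => add_nonneg (hf.1 x) (hg.1 x), fun a => ?_⟩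
    simpa only [add_sub_add_comm] using ih (hf.2 a) (hg.2 a)

theorem const_mul {c : ℝ} (hc : 0 ≤ c) (hf : IsCMOfOrder n f) :
    IsCMOfOrder n fun x => c * f x := by
  induction n generalizing f with
  | zero => exact fun x => mul_nonneg hc (hf x)
  | succ n ih =>
    refine ⟨fun x => mul_nonneg hc (hf.1 x), fun a => ?_⟩
    simpa only [mul_sub] using ih (hf.2 a)

theorem comp_sup_right (hf : IsCMOfOrder n f) (b : M) : IsCMOfOrder n fun x => f (x ⊔ b) := by
  induction n generalizing f with
  | zero => exact fun x => hf (x ⊔ b)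
  | succ n ih =>
    refine ⟨fun x => hf.1 (x ⊔ b), fun a => ?_⟩
    simpa only [sup_right_comm _ b a] using ih (hf.2 a)

theorem mul (hf : IsCMOfOrder n f) (hg : IsCMOfOrder n g) :
    IsCMOfOrder n fun x => f x * g x := by
  induction n generalizing f g with
  | zero => exact fun x => mul_nonneg (hf x) (hg x)
  | succ n ih =>
    refine ⟨fun x => mul_nonneg (hf.1 x) (hg.1 x), fun a => ?_⟩
    have hleibniz : (fun x => f x * g x - f (x ⊔ a) * g (x ⊔ a)) =
        fun x => (f x - f (x ⊔ a)) * g x + f (x ⊔ a) * (g x - g (x ⊔ a)) := by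
      funext x
      ring
    rw [hleibniz]
    exact (ih (hf.2 a) hg.of_succ).add (ih (hf.of_succ.comp_sup_right a) (hg.2 a))

theorem of_tendsto {α : Type*} {l : Filter α} [l.NeBot] {F : α → M → ℝ}
    (hF : ∀ᶠ t in l, IsCMOfOrder n (F t)) (hlim : ∀ x, Tendsto (F · x) l (𝓝 (f x))) :
    IsCMOfOrder n f := by
  induction n generalizing f F with
  | zero => exact fun x => ge_of_tendsto (hlim x) (hF.mono fun _ h => h x)
  | succ n ih =>
    exact ⟨fun x => ge_of_tendsto (hlim x) (hF.mono fun _ h => h.1 x),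
      fun a => ih (hF.mono fun _ h => h.2 a) fun x => (hlim x).sub (hlim (x ⊔ a))⟩

theorem sub_of_hasDerivAt {H H' : ℝ → M → ℝ} {a b : ℝ} (hab : a ≤ b)
    (hH : ∀ t ∈ Icc a b, ∀ x, HasDerivAt (H · x) (H' t x) t)
    (hH' : ∀ t ∈ Icc a b, IsCMOfOrder n (H' t)) : IsCMOfOrder n fun x => H b x - H a x := by
  induction n generalizing H H' with
  | zero => exact fun x => sub_nonneg.2 (le_of_hasDerivAt_nonneg hab (hH · · x) (hH' · · x))
  | succ n ih =>
    refine ⟨fun x => sub_nonneg.2 (le_of_hasDerivAt_nonneg hab (hH · · x) fun t ht =>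
      (hH' t ht).1 x), fun c => ?_⟩
    simpa only [sub_sub_sub_comm] using ih (H := fun t x => H t x - H t (x ⊔ c))
      (fun t ht x => (hH t ht x).sub (hH t ht (x ⊔ c))) fun t ht => (hH' t ht).2 c

theorem max_sub_zero (hg : ∀ x y, g (x ⊔ y) = max (g x) (g y)) (c : ℝ) :
    IsCMOfOrder n fun x => max (c - g x) 0 := by
  induction n generalizing c with
  | zero => exact fun x => le_max_right _ _
  | succ n ih =>
    refine ⟨fun x => le_max_right _ _, fun a => ?_⟩
    have htruncate : ∀ x,
        max (c - g x) 0 - max (c - g (x ⊔ a)) 0 = max (min c (g a) - g x) 0 := fun x => by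
      grind
    simpa only [htruncate] using ih (min c (g a))

theorem sum_powerset_nonneg {ι : Type*} [DecidableEq ι] {A : Finset ι} {F : Finset ι → ℝ}
    (hF : IsCMOfOrder A.card F) : 0 ≤ ∑ S ∈ A.powerset, (-1 : ℝ) ^ S.card * F S := by
  induction A using Finset.induction_on generalizing F with
  | empty => simpa using hF.nonneg ∅
  | insert i A hi ih =>
    rw [Finset.card_insert_of_notMem hi] at hF
    refine (ih (hF.2 {i})).trans_eq ?_
    rw [Finset.sum_powerset_insert hi, ← Finset.sum_add_distrib]
    refine Finset.sum_congr rfl fun S hS => ?_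
    have hiS : i ∉ S := fun h => hi (Finset.mem_powerset.1 hS h)
    rw [Finset.card_insert_of_notMem hiS, Finset.sup_eq_union, Finset.union_singleton, pow_succ]
    ring

end IsCMOfOrder

namespace IsAlternating

variable {g h : M → ℝ}

theorem const (c : ℝ) : IsAlternating fun _ : M => c := fun n _ => by
  simpa only [sub_self] using IsCMOfOrder.zero (n := n)

theorem add (hg : IsAlternating g) (hh : IsAlternating h) :
    IsAlternating fun x => g x + h x := fun n a => by
  simpa only [add_sub_add_comm] using (hg n a).add (hh n a)

theorem const_mul {c : ℝ} (hc : 0 ≤ c) (hg : IsAlternating g) :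
    IsAlternating fun x => c * g x := fun n a => by
  simpa only [mul_sub] using (hg n a).const_mul hc

theorem sum {ι : Type*} {s : Finset ι} {g : ι → M → ℝ} (hg : ∀ i ∈ s, IsAlternating (g i)) :
    IsAlternating fun x => ∑ i ∈ s, g i x := by
  induction s using Finset.cons_induction with
  | empty => simpa only [Finset.sum_empty] using const 0
  | cons i s hi ih =>
    simp only [Finset.sum_cons]
    exact (hg i (Finset.mem_cons_self i s)).add
      (ih fun j hj => hg j (Finset.mem_cons_of_mem hj))

theorem comp_sup_right (hg : IsAlternating g) (b : M) : IsAlternating fun x => g (x ⊔ b) :=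
  fun n a => by simpa only [sup_right_comm _ b a] using (hg n a).comp_sup_right b

theorem of_tendsto {α : Type*} {l : Filter α} [l.NeBot] {G : α → M → ℝ}
    (hG : ∀ᶠ t in l, IsAlternating (G t)) (hlim : ∀ x, Tendsto (G · x) l (𝓝 (g x))) :
    IsAlternating g := fun n a =>
  IsCMOfOrder.of_tendsto (hG.mono fun _ h => h n a) fun x => (hlim (x ⊔ a)).sub (hlim x)

theorem of_map_sup (hg : ∀ x y, g (x ⊔ y) = max (g x) (g y)) : IsAlternating g := fun n a => by
  have hdiff : ∀ x, g (x ⊔ a) - g x = max (g a - g x) 0 := fun x => by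
    rw [hg, max_comm, ← max_sub_sub_right, sub_self]
  simpa only [hdiff] using IsCMOfOrder.max_sub_zero (n := n) hg (g a)

theorem isCMOfOrder_comp_sub_comp {n : ℕ} {f f' : ℝ → ℝ}
    (hf : ∀ t, 0 < t → HasDerivAt f (f' t) t)
    (hf' : ∀ k : M → ℝ, IsAlternating k → (∀ x, 0 < k x) → IsCMOfOrder n fun x => f' (k x))
    (hg : IsAlternating g) (hpos : ∀ x, 0 < g x) (a : M) :
    IsCMOfOrder n fun x => f (g (x ⊔ a)) - f (g x) := by
  -- Along the segment `γ` from `g` to its translate, which stays alternating, the derivative of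
  -- `f ∘ γ` is `f' ∘ γ` times a difference of `g`.
  let γ (t : ℝ) (x : M) : ℝ := (1 - t) * g x + t * g (x ⊔ a)
  have hγ_pos : ∀ t ∈ Icc (0 : ℝ) 1, ∀ x, 0 < γ t x := fun t ht x =>
    convex_Ioi (0 : ℝ) (hpos x) (hpos (x ⊔ a)) (sub_nonneg.2 ht.2) ht.1 (sub_add_cancel 1 t)
  have hγ_alt : ∀ t ∈ Icc (0 : ℝ) 1, IsAlternating (γ t) := fun t ht =>
    (hg.const_mul (sub_nonneg.2 ht.2)).add ((hg.comp_sup_right a).const_mul ht.1)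
  have hγ_deriv : ∀ t x, HasDerivAt (γ · x) (g (x ⊔ a) - g x) t := fun t x => by
    have h := (((hasDerivAt_id t).const_sub 1).mul_const (g x)).add
      ((hasDerivAt_id t).mul_const (g (x ⊔ a)))
    convert! h using 1
    ring
  have hpath := IsCMOfOrder.sub_of_hasDerivAt zero_le_one (H := fun t x => f (γ t x))
    (fun t ht x => (hf _ (hγ_pos t ht x)).comp t (hγ_deriv t x))
    (fun t ht => (hf' _ (hγ_alt t ht) (hγ_pos t ht)).mul (hg n a))
  simpa only [γ, sub_self, sub_zero, zero_mul, one_mul, zero_add, add_zero] using hpath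

end IsAlternating

namespace IsCompletelyMonotone

variable {f : ℝ → ℝ} {g : M → ℝ}

theorem hasDerivAt (hf : IsCompletelyMonotone f) {t : ℝ} (ht : 0 < t) :
    HasDerivAt f (deriv f t) t :=
  ((hf.1.differentiableOn (by simp) t ht).differentiableAt (Ioi_mem_nhds ht)).hasDerivAt

theorem nonneg (hf : IsCompletelyMonotone f) {t : ℝ} (ht : 0 < t) : 0 ≤ f t := by
  simpa using hf.2 0 t ht

theorem neg_deriv (hf : IsCompletelyMonotone f) : IsCompletelyMonotone fun t => -deriv f t := by
  refine ⟨((contDiffOn_infty_iff_deriv_of_isOpen isOpen_Ioi).1 hf.1).2.neg, fun n t ht => ?_⟩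
  have h := hf.2 (n + 1) t ht
  rw [iteratedDeriv_succ', pow_succ] at h
  rw [iteratedDeriv_fun_neg]
  linarith

theorem comp_of_pos (hf : IsCompletelyMonotone f) (hg : IsAlternating g) (hpos : ∀ x, 0 < g x)
    (n : ℕ) : IsCMOfOrder n fun x => f (g x) := by
  induction n generalizing f g with
  | zero => exact fun x => hf.nonneg (hpos x)
  | succ n ih =>
    refine ⟨fun x => hf.nonneg (hpos x), fun a => ?_⟩
    simpa only [neg_sub_neg] using hg.isCMOfOrder_comp_sub_comp (f := fun t => -f t)
      (fun t ht => (hf.hasDerivAt ht).neg) (fun _ hk hk' => (ih hf.neg_deriv hk hk' :)) hpos a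

theorem comp (hf : IsCompletelyMonotone f) (hfc : ContinuousOn f (Ici 0)) (hg : IsAlternating g)
    (hg0 : ∀ x, 0 ≤ g x) (n : ℕ) : IsCMOfOrder n fun x => f (g x) := by
  refine .of_tendsto ?_ fun x => tendsto_apply_add_nhdsGT hfc (hg0 x)
  filter_upwards [self_mem_nhdsWithin] with ε hε
  exact hf.comp_of_pos (hg.add (.const ε)) (fun x => add_pos_of_nonneg_of_pos (hg0 x) hε) n

end IsCompletelyMonotone

theorem IsAlternating.comp_of_deriv {f : ℝ → ℝ} {g : M → ℝ} (hf : DifferentiableOn ℝ f (Ioi 0))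
    (hf' : IsCompletelyMonotone (deriv f)) (hfc : ContinuousOn f (Ici 0)) (hg : IsAlternating g)
    (hg0 : ∀ x, 0 ≤ g x) : IsAlternating fun x => f (g x) := by
  refine .of_tendsto ?_ fun x => tendsto_apply_add_nhdsGT hfc (hg0 x)
  filter_upwards [self_mem_nhdsWithin] with ε hε n a
  exact (hg.add (.const ε)).isCMOfOrder_comp_sub_comp
    (fun t ht => (hf.differentiableAt (Ioi_mem_nhds ht)).hasDerivAt)
    (fun _ hk hk' => hf'.comp_of_pos hk hk' n) (fun x => add_pos_of_nonneg_of_pos (hg0 x) hε) a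

end Semilattice

theorem isAlternating_card_mul (ι : Type*) [DecidableEq ι] {r : ℝ} (hr : 0 ≤ r) :
    IsAlternating fun S : Finset ι => (S.card : ℝ) * r := fun n A => by
  have halt : IsAlternating fun S : Finset ι => ∑ i ∈ A, if i ∈ S then r else 0 :=
    IsAlternating.sum fun i _ => IsAlternating.of_map_sup fun S R => by
      by_cases hS : i ∈ S <;> by_cases hR : i ∈ R <;> simp [hS, hR, hr]
  have hdiff : ∀ S : Finset ι, ((S ⊔ A).card : ℝ) * r - S.card * r =
      (∑ i ∈ A, if i ∈ S ⊔ A then r else 0) - ∑ i ∈ A, if i ∈ S then r else 0 := fun S => by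
    have hcard : ((S ∪ A).card : ℝ) + (A ∩ S).card = S.card + A.card := by
      rw [Finset.inter_comm]
      exact_mod_cast Finset.card_union_add_card_inter S A
    simp only [Finset.sup_eq_union, Finset.sum_ite_mem, Finset.sum_const, nsmul_eq_mul,
      Finset.inter_eq_left.2 Finset.subset_union_right]
    linear_combination r * hcard
  simpa only [hdiff] using halt n A

theorem IsCompletelyMonotone.eq_zero_of_forall_two_mul_le {f : ℝ → ℝ}
    (hf : IsCompletelyMonotone f) (hfc : ContinuousOn f (Ici 0)) {r : ℝ} (hr : 0 < r)
    (h0 : ∀ t, 2 * r ≤ t → f t = 0) : f r = 0 := by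
  -- The iterated difference of `S ↦ f (r * card S)` over `n + 1` atoms is `f 0 - (n + 1) * f r`,
  -- all further terms being zero.
  have hle (n : ℕ) : (n + 1 : ℕ) * f r ≤ f 0 := by
    have hsum := (hf.comp hfc (isAlternating_card_mul (Fin (n + 1)) hr.le)
      (fun S => by positivity) (Finset.univ : Finset (Fin (n + 1))).card).sum_powerset_nonneg
    have htail : ∀ m ∈ Finset.range n, (n + 1).choose (m + 1 + 1) •
        ((-1 : ℝ) ^ (m + 1 + 1) * f ((m + 1 + 1 : ℕ) * r)) = 0 := fun m _ => by
      have hm : (2 : ℝ) * r ≤ (m + 1 + 1 : ℕ) * r := by gcongr; norm_cast; omega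
      rw [h0 _ hm, mul_zero, smul_zero]
    have hexpand : ∑ m ∈ Finset.range (n + 1 + 1), (n + 1).choose m •
        ((-1 : ℝ) ^ m * f (m * r)) = f 0 - (n + 1 : ℕ) * f r := by
      rw [Finset.sum_range_succ', Finset.sum_range_succ', Finset.sum_eq_zero htail]
      simp [neg_add_eq_sub]
    rwa [Finset.sum_powerset_apply_card (fun m : ℕ => (-1 : ℝ) ^ m * f (m * r)),
      Finset.card_univ, Fintype.card_fin, hexpand, sub_nonneg] at hsum
  by_contra hne
  have hpos : 0 < f r := (hf.nonneg hr).lt_of_ne' hne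
  obtain ⟨n, hn⟩ := exists_nat_gt (f 0 / f r)
  rw [div_lt_iff₀ hpos] at hn
  have hlt : (n : ℝ) * f r ≤ (n + 1 : ℕ) * f r := by gcongr; exact n.le_succ
  exact (hn.trans_le hlt).not_ge (hle n)

/-! Completely monotone generators -/

namespace IsGenerator

variable {ψ : ℝ≥0∞ → ℝ}

theorem apply_genInv (h : IsGenerator ψ) {s : ℝ} (hs : s ∈ Icc (0 : ℝ) 1) :
    ψ (genInv ψ s) = s := by
  have hattained : (ψ ⁻¹' {s}).Nonempty := mem_range_of_exists_le_of_exists_ge h.continuous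
    ⟨⊤, h.map_top ▸ hs.1⟩ ⟨0, h.map_zero ▸ hs.2⟩
  exact (isClosed_singleton.preimage h.continuous).sInf_mem hattained

theorem genInv_one (h : IsGenerator ψ) : genInv ψ 1 = 0 :=
  le_bot_iff.1 (sInf_le h.map_zero)

theorem antitoneOn_genInv (h : IsGenerator ψ) : AntitoneOn (genInv ψ) (Icc 0 1) :=
  fun s hs t ht hst => by
    by_contra! hlt
    have hts := h.antitone hlt.le
    rw [h.apply_genInv hs, h.apply_genInv ht] at hts
    exact hlt.ne (by rw [le_antisymm hst hts])

theorem genInv_ne_top (h : IsGenerator ψ) {s : ℝ} (hs : s ∈ Ioc (0 : ℝ) 1) :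
    genInv ψ s ≠ ⊤ := fun htop => by
  have hval := h.apply_genInv (Ioc_subset_Icc_self hs)
  rw [htop, h.map_top] at hval
  exact hs.1.ne hval

variable {ι : Type*} {s : Finset ι} {x : ι → ℝ}

theorem archValue_mem (h : IsGenerator ψ) (s : Finset ι) (x : ι → ℝ) :
    archValue ψ s x ∈ Icc (0 : ℝ) 1 :=
  h.mem_unit _

theorem archValue_le (h : IsGenerator ψ) {i : ι} (hi : i ∈ s) (hxi : x i ∈ Icc (0 : ℝ) 1) :
    archValue ψ s x ≤ x i :=
  (h.antitone (Finset.single_le_sum_of_canonicallyOrdered hi)).trans_eq (h.apply_genInv hxi)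

theorem archValue_eq_of_forall_ne_eq_one (h : IsGenerator ψ) {i : ι} (hi : i ∈ s)
    (hxi : x i ∈ Icc (0 : ℝ) 1) (hx : ∀ j ∈ s, j ≠ i → x j = 1) : archValue ψ s x = x i := by
  rw [archValue, Finset.sum_eq_single_of_mem i hi fun j hj hji => by
    rw [hx j hj hji, h.genInv_one], h.apply_genInv hxi]

theorem archValue_eq_one (h : IsGenerator ψ) (hx : ∀ i ∈ s, x i = 1) : archValue ψ s x = 1 := by
  rw [archValue, Finset.sum_eq_zero fun i hi => by rw [hx i hi, h.genInv_one], h.map_zero]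

end IsGenerator

namespace IsCMGenerator

variable {ψ : ℝ≥0∞ → ℝ}

theorem continuous_comp_ofReal (h : IsCMGenerator ψ) :
    Continuous fun t : ℝ => ψ (ENNReal.ofReal t) :=
  h.1.continuous.comp ENNReal.continuous_ofReal

theorem apply_half_eq_zero (h : IsCMGenerator ψ) {r : ℝ} (hr : 0 < r)
    (h0 : ψ (ENNReal.ofReal r) = 0) : ψ (ENNReal.ofReal (r / 2)) = 0 := by
  refine h.2.eq_zero_of_forall_two_mul_le h.continuous_comp_ofReal.continuousOn (half_pos hr)
    fun t ht => le_antisymm ?_ (h.1.mem_unit _).1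
  rw [← h0]
  exact h.1.antitone (ENNReal.ofReal_le_ofReal (by linarith))

theorem pos (h : IsCMGenerator ψ) {t : ℝ≥0∞} (ht : t ≠ ⊤) : 0 < ψ t := by
  refine (h.1.mem_unit t).1.lt_of_ne' fun hzero => ?_
  have ht0 : t ≠ 0 := fun h0 => one_ne_zero (h.1.map_zero.symm.trans (h0 ▸ hzero))
  have hr : 0 < t.toReal := ENNReal.toReal_pos ht0 ht
  have hhalves (n : ℕ) : ψ (ENNReal.ofReal (t.toReal / 2 ^ n)) = 0 := by
    induction n with
    | zero => simpa [ENNReal.ofReal_toReal ht] using hzero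
    | succ n ih =>
      rw [pow_succ, ← div_div]
      exact h.apply_half_eq_zero (by positivity) ih
  have hlim : Tendsto (fun n : ℕ => t.toReal / 2 ^ n) atTop (𝓝 0) :=
    tendsto_const_nhds.div_atTop (tendsto_pow_atTop_atTop_of_one_lt one_lt_two)
  have hψ := (h.continuous_comp_ofReal.tendsto 0).comp hlim
  simp only [Function.comp_def, hhalves, ENNReal.ofReal_zero, h.1.map_zero] at hψ
  exact zero_ne_one (tendsto_nhds_unique tendsto_const_nhds hψ)

theorem strictAnti (h : IsCMGenerator ψ) : StrictAnti ψ := by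
  have htop : sInf {t | ψ t = 0} = ⊤ :=
    sInf_eq_top.2 fun t ht => by_contra fun hne => (h.pos hne).ne' ht
  have hanti := h.1.strictAntiOn
  rwa [htop, ← bot_eq_zero, Icc_bot_top, strictAntiOn_univ] at hanti

theorem genInv_archValue {ι : Type*} (h : IsCMGenerator ψ) (s : Finset ι) (x : ι → ℝ) :
    genInv ψ (archValue ψ s x) = ∑ i ∈ s, genInv ψ (x i) := by
  simp only [archValue, genInv, h.strictAnti.injective.eq_iff, ofPred_eq_eq_singleton,
    sInf_singleton]

theorem continuousOn_genInv (h : IsCMGenerator ψ) : ContinuousOn (genInv ψ) (Icc 0 1) := by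
  have hemb := h.1.continuous.isClosedEmbedding h.strictAnti.injective
  rw [continuousOn_iff_continuous_domRestrict, hemb.isInducing.continuous_iff]
  exact continuous_subtype_val.congr fun s => (h.1.apply_genInv s.2).symm

theorem archValue_pos {ι : Type*} (h : IsCMGenerator ψ) {s : Finset ι} {x : ι → ℝ}
    (hx : ∀ i ∈ s, x i ∈ Ioc (0 : ℝ) 1) : 0 < archValue ψ s x :=
  h.pos (ENNReal.sum_ne_top.2 fun i hi => h.1.genInv_ne_top (hx i hi))

theorem continuousOn_archValue {ι X : Type*} [TopologicalSpace X] (h : IsCMGenerator ψ)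
    {s : Finset ι} {f : ι → X → ℝ} {t : Set X} (hf : ∀ i ∈ s, ContinuousOn (f i) t)
    (hmem : ∀ i ∈ s, MapsTo (f i) t (Icc 0 1)) :
    ContinuousOn (fun x => archValue ψ s fun i => f i x) t :=
  h.1.continuous.comp_continuousOn
    (continuousOn_finsetSum s fun i hi => h.continuousOn_genInv.comp (hf i hi) (hmem i hi))

end IsCMGenerator

namespace SufficientNesting

variable {ψ₁ ψ₂ : ℝ≥0∞ → ℝ}

theorem genInv_apply_ne_top (h : SufficientNesting ψ₁ ψ₂) {t : ℝ≥0∞} (ht : t ≠ ⊤) :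
    genInv ψ₁ (ψ₂ t) ≠ ⊤ :=
  h.1.1.genInv_ne_top ⟨h.2.1.pos ht, (h.2.1.1.mem_unit t).2⟩

theorem continuous_genInv_comp (h : SufficientNesting ψ₁ ψ₂) :
    Continuous fun t : ℝ => (genInv ψ₁ (ψ₂ (ENNReal.ofReal t))).toReal :=
  ENNReal.continuousOn_toReal.comp_continuous
    (h.1.continuousOn_genInv.comp_continuous h.2.1.continuous_comp_ofReal
      fun _ => h.2.1.1.mem_unit _)
    fun _ => h.genInv_apply_ne_top ENNReal.ofReal_ne_top

theorem isAlternating_genInv_comp (h : SufficientNesting ψ₁ ψ₂) {M : Type*} [SemilatticeSup M]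
    {x : M → ℝ} (hx : ∀ p, x p ∈ Ioc (0 : ℝ) 1)
    (hg : IsAlternating fun p => (genInv ψ₂ (x p)).toReal) :
    IsAlternating fun p => (genInv ψ₁ (x p)).toReal := by
  have hcomp := hg.comp_of_deriv h.2.2.1 h.2.2.2 h.continuous_genInv_comp.continuousOn
    fun _ => ENNReal.toReal_nonneg
  simpa only [ENNReal.ofReal_toReal (h.2.1.1.genInv_ne_top (hx _)),
    h.2.1.1.apply_genInv (Ioc_subset_Icc_self (hx _))] using hcomp

end SufficientNesting
/-! Hierarchical Archimedean functions -/

/-- The nodes below `n` are numbered so that children precede their parents. -/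
def ChildrenPrecede (n : ℕ) (children : ℕ → Finset ℕ) : Prop :=
  ∀ v < n, ∀ w ∈ children v, w < v

/-- The forks `d, …, n - 1` carry completely monotone generators, and the sufficient nesting
condition holds along every edge between forks. -/
structure IsNestedLabeling (d n : ℕ) (children : ℕ → Finset ℕ) (lab : ℕ → ℝ≥0∞ → ℝ) : Prop where
  isCMGenerator : ∀ v, d ≤ v → v < n → IsCMGenerator (lab v)
  nesting : ∀ v, d ≤ v → v < n → ∀ w ∈ children v, d ≤ w → SufficientNesting (lab v) (lab w)

/-- `IsDescendant n children v w`: the node `w` lies in the subtree rooted in `v`. -/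
def IsDescendant (n : ℕ) (children : ℕ → Finset ℕ) : ℕ → ℕ → Prop :=
  Relation.ReflTransGen fun v w => v < n ∧ w ∈ children v

/-- The vector of node values belonging to the argument `u`, by recursion on the node. A child that
does not precede its parent contributes nothing; under `ChildrenPrecede` this does not occur. -/
noncomputable def nodeValue (d : ℕ) (children : ℕ → Finset ℕ) (lab : ℕ → ℝ≥0∞ → ℝ)
    (u : Fin d → ℝ) (v : ℕ) : ℝ :=
  if h : v < d then u ⟨v, h⟩
  else lab v (∑ w ∈ children v, if _hw : w < v then
    genInv (lab v) (nodeValue d children lab u w) else 0)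
termination_by v

section NodeValue

variable {d n : ℕ} {children : ℕ → Finset ℕ} {lab : ℕ → ℝ≥0∞ → ℝ} {u : Fin d → ℝ} {v w : ℕ}

theorem nodeValue_leaf (hv : v < d) : nodeValue d children lab u v = u ⟨v, hv⟩ := by
  rw [nodeValue, dif_pos hv]

theorem nodeValue_fork (hlt : ChildrenPrecede n children) (hdv : d ≤ v) (hv : v < n) :
    nodeValue d children lab u v =
      archValue (lab v) (children v) (nodeValue d children lab u) := by
  rw [nodeValue, dif_neg hdv.not_gt, archValue,
    Finset.sum_congr rfl fun w hw => dif_pos (hlt v hv w hw)]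

theorem nodeValue_mem_Icc (hlt : ChildrenPrecede n children)
    (hlab : ∀ v, d ≤ v → v < n → IsGenerator (lab v)) (hu : u ∈ Icc (0 : Fin d → ℝ) 1)
    (hv : v < n) : nodeValue d children lab u v ∈ Icc (0 : ℝ) 1 := by
  rcases lt_or_ge v d with hvd | hdv
  · rw [nodeValue_leaf hvd]
    exact ⟨hu.1 _, hu.2 _⟩
  · rw [nodeValue_fork hlt hdv hv]
    exact (hlab v hdv hv).archValue_mem _ _

theorem nodeValue_mem_Ioc (hlt : ChildrenPrecede n children)
    (hlab : ∀ v, d ≤ v → v < n → IsCMGenerator (lab v)) (hu : ∀ i, u i ∈ Ioc (0 : ℝ) 1)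
    (hv : v < n) : nodeValue d children lab u v ∈ Ioc (0 : ℝ) 1 := by
  induction v using Nat.strong_induction_on with
  | _ v ih =>
    rcases lt_or_ge v d with hvd | hdv
    · rw [nodeValue_leaf hvd]
      exact hu _
    · rw [nodeValue_fork hlt hdv hv]
      have hpos := (hlab v hdv hv).archValue_pos fun w hw =>
        ih w (hlt v hv w hw) ((hlt v hv w hw).trans hv)
      exact ⟨hpos, ((hlab v hdv hv).1.archValue_mem _ _).2⟩

theorem continuousOn_nodeValue (hlt : ChildrenPrecede n children)
    (hlab : ∀ v, d ≤ v → v < n → IsCMGenerator (lab v)) (hv : v < n) :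
    ContinuousOn (fun u => nodeValue d children lab u v) (Icc 0 1) := by
  induction v using Nat.strong_induction_on with
  | _ v ih =>
    rcases lt_or_ge v d with hvd | hdv
    · simp only [nodeValue_leaf hvd]
      exact (continuous_apply _).continuousOn
    · simp only [nodeValue_fork hlt hdv hv]
      have hwn : ∀ w ∈ children v, w < n := fun w hw => (hlt v hv w hw).trans hv
      exact (hlab v hdv hv).continuousOn_archValue (fun w hw => ih w (hlt v hv w hw) (hwn w hw))
        fun w hw u hu => nodeValue_mem_Icc hlt (fun v hdv hv => (hlab v hdv hv).1) hu (hwn w hw)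

theorem isDescendant_le (hlt : ChildrenPrecede n children) (hvw : IsDescendant n children v w) :
    w ≤ v := by
  induction hvw with
  | refl => exact le_rfl
  | tail _ hstep ih => exact (hlt _ hstep.1 _ hstep.2).le.trans ih

theorem isDescendant_of_nodeValue_ne_one (hlt : ChildrenPrecede n children)
    (hlab : ∀ v, d ≤ v → v < n → IsGenerator (lab v)) {i : Fin d} (hu : ∀ j, j ≠ i → u j = 1)
    (hv : v < n) (hne : nodeValue d children lab u v ≠ 1) : IsDescendant n children v i := by
  induction v using Nat.strong_induction_on with
  | _ v ih =>
    rcases lt_or_ge v d with hvd | hdv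
    · rw [nodeValue_leaf hvd] at hne
      have hvi : (⟨v, hvd⟩ : Fin d) = i := by_contra fun h => hne (hu _ h)
      exact hvi ▸ Relation.ReflTransGen.refl
    · rw [nodeValue_fork hlt hdv hv] at hne
      obtain ⟨w, hw, hw1⟩ : ∃ w ∈ children v, nodeValue d children lab u w ≠ 1 := by
        by_contra! hone
        exact hne ((hlab v hdv hv).archValue_eq_one hone)
      have hwv := hlt v hv w hw
      exact .head ⟨hv, hw⟩ (ih w hwv (hwv.trans hv) hw1)

theorem isAlternating_genInv_nodeValue {M : Type*} [SemilatticeSup M]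
    (hlt : ChildrenPrecede n children) (hlab : IsNestedLabeling d n children lab)
    {u : M → Fin d → ℝ} (hu : ∀ p i, u p i ∈ Ioc (0 : ℝ) 1)
    (hsup : ∀ p q, u (p ⊔ q) = u p ⊓ u q) (hdv : d ≤ v) (hv : v < n) :
    IsAlternating fun p => (genInv (lab v) (nodeValue d children lab (u p) v)).toReal := by
  induction v using Nat.strong_induction_on with
  | _ v ih =>
    have hgen := hlab.isCMGenerator v hdv hv
    have hmem : ∀ w ∈ children v, ∀ p, nodeValue d children lab (u p) w ∈ Ioc (0 : ℝ) 1 :=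
      fun w hw p => nodeValue_mem_Ioc hlt hlab.isCMGenerator (hu p) ((hlt v hv w hw).trans hv)
    have hsum : ∀ p, (genInv (lab v) (nodeValue d children lab (u p) v)).toReal =
        ∑ w ∈ children v, (genInv (lab v) (nodeValue d children lab (u p) w)).toReal := fun p => by
      rw [nodeValue_fork hlt hdv hv, hgen.genInv_archValue,
        ENNReal.toReal_sum fun w hw => hgen.1.genInv_ne_top (hmem w hw p)]
    simp only [hsum]
    refine IsAlternating.sum fun w hw => ?_
    rcases lt_or_ge w d with hwd | hdw
    · refine IsAlternating.of_map_sup fun p q => ?_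
      simp only [nodeValue_leaf hwd, hsup, Pi.inf_apply]
      rw [hgen.1.antitoneOn_genInv.map_inf (Ioc_subset_Icc_self (hu p _))
        (Ioc_subset_Icc_self (hu q _)), ENNReal.toReal_sup (hgen.1.genInv_ne_top (hu p _))
          (hgen.1.genInv_ne_top (hu q _))]
    · exact (hlab.nesting v hdv hv w hw hdw).isAlternating_genInv_comp (hmem w hw)
        (ih w (hlt v hv w hw) hdw ((hlt v hv w hw).trans hv))

theorem isCMOfOrder_nodeValue {M : Type*} [SemilatticeSup M]
    (hlt : ChildrenPrecede n children) (hlab : IsNestedLabeling d n children lab)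
    {u : M → Fin d → ℝ} (hu : ∀ p i, u p i ∈ Ioc (0 : ℝ) 1)
    (hsup : ∀ p q, u (p ⊔ q) = u p ⊓ u q) (hdv : d ≤ v) (hv : v < n) (m : ℕ) :
    IsCMOfOrder m fun p => nodeValue d children lab (u p) v := by
  have hgen := hlab.isCMGenerator v hdv hv
  have hmem : ∀ p, nodeValue d children lab (u p) v ∈ Ioc (0 : ℝ) 1 := fun p =>
    nodeValue_mem_Ioc hlt hlab.isCMGenerator (hu p) hv
  have hcomp := hgen.2.comp hgen.continuous_comp_ofReal.continuousOn
    (isAlternating_genInv_nodeValue hlt hlab hu hsup hdv hv) (fun _ => ENNReal.toReal_nonneg) m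
  simpa only [ENNReal.ofReal_toReal (hgen.1.genInv_ne_top (hmem _)),
    hgen.1.apply_genInv (Ioc_subset_Icc_self (hmem _))] using hcomp

theorem nodeValue_boxSum_nonneg_of_pos (hlt : ChildrenPrecede n children)
    (hlab : IsNestedLabeling d n children lab) (hdv : d ≤ v) (hv : v < n) {a b : Fin d → ℝ}
    (ha : ∀ i, 0 < a i) (hab : a ≤ b) (hb : b ≤ 1) :
    0 ≤ ∑ S : Finset (Fin d),
      (-1 : ℝ) ^ S.card * nodeValue d children lab (fun i => if i ∈ S then a i else b i) v := by
  rw [← Finset.powerset_univ]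
  refine IsCMOfOrder.sum_powerset_nonneg (isCMOfOrder_nodeValue hlt hlab (fun S i => ?_)
    (fun S R => funext fun i => ?_) hdv hv _)
  · split_ifs
    exacts [⟨ha i, (hab i).trans (hb i)⟩, ⟨(ha i).trans_le (hab i), hb i⟩]
  · have habi := hab i
    by_cases hS : i ∈ S <;> by_cases hR : i ∈ R <;> simp [hS, hR, habi]

end NodeValue

theorem boxSum_nonneg_of_continuousOn {n : ℕ} {C : (Fin n → ℝ) → ℝ} (hC : ContinuousOn C (Icc 0 1))
    (hpos : ∀ a b : Fin n → ℝ, (∀ i, 0 < a i) → a ≤ b → b ≤ 1 →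
      0 ≤ ∑ S : Finset (Fin n), (-1 : ℝ) ^ S.card * C fun i => if i ∈ S then a i else b i)
    {a b : Fin n → ℝ} (ha : a ∈ Icc (0 : Fin n → ℝ) 1) (hb : b ∈ Icc (0 : Fin n → ℝ) 1)
    (hab : a ≤ b) :
    0 ≤ ∑ S : Finset (Fin n), (-1 : ℝ) ^ S.card * C fun i => if i ∈ S then a i else b i := by
  have hlim : ∀ u ∈ Icc (0 : Fin n → ℝ) 1,
      Tendsto (fun ε : ℝ => C fun i => max (u i) ε) (𝓝[Ioc 0 1] 0) (𝓝 (C u)) := fun u hu => by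
    refine (hC u hu).tendsto.comp (tendsto_nhdsWithin_iff.2 ⟨?_, ?_⟩)
    · refine Tendsto.mono_left (Continuous.tendsto' (by fun_prop) _ _ ?_) nhdsWithin_le_nhds
      exact funext fun i => max_eq_left (hu.1 i)
    · filter_upwards [self_mem_nhdsWithin] with ε hε
      exact ⟨fun i => le_max_of_le_left (hu.1 i), fun i => max_le (hu.2 i) hε.2⟩
  have hvertex : ∀ S : Finset (Fin n), (fun i => if i ∈ S then a i else b i) ∈ Icc 0 1 :=
    fun S => ⟨fun i => by dsimp only; split_ifs; exacts [ha.1 i, hb.1 i],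
      fun i => by dsimp only; split_ifs; exacts [ha.2 i, hb.2 i]⟩
  have : (𝓝[Ioc 0 1] (0 : ℝ)).NeBot := by
    rw [nhdsWithin_Ioc_eq_nhdsGT one_pos]
    infer_instance
  refine ge_of_tendsto (tendsto_finsetSum _ fun S _ => (hlim _ (hvertex S)).const_mul _) ?_
  filter_upwards [self_mem_nhdsWithin] with ε hε
  simpa only [apply_ite (max · ε)] using hpos (fun i => max (a i) ε) (fun i => max (b i) ε)
    (fun i => lt_max_of_lt_right hε.1) (fun i => max_le_max_right ε (hab i))
    fun i => max_le (hb.2 i) hε.2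

namespace IsHACStructure

variable {d k : ℕ} {children : ℕ → Finset ℕ} {lab : ℕ → ℝ≥0∞ → ℝ} {u : Fin d → ℝ}
  {v v' w w' : ℕ}

theorem le_of_mem_children (h : IsHACStructure d k children) (hw : w ∈ children v) : d ≤ v := by
  by_contra! hv
  simp [h.leaf v hv] at hw

theorem parent_unique (h : IsHACStructure d k children) (hv : v < d + k) (hv' : v' < d + k)
    (hw : w ∈ children v) (hw' : w ∈ children v') : v = v' := by
  have hne : w ≠ d + k - 1 := fun he => h.root v hv (he ▸ hw)
  have hlt := h.child_lt v hv w hw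
  exact (h.parent w (by omega)).unique ⟨hv, hw⟩ ⟨hv', hw'⟩

theorem isDescendant_root (h : IsHACStructure d k children) (hw : w < d + k) :
    IsDescendant (d + k) children (d + k - 1) w := by
  have hreach := h.reachable w hw
  have hroot : d + k - 1 < d + k := by omega
  suffices IsDescendant (d + k) children (d + k - 1) w ∧ w < d + k from this.1
  clear hw
  induction hreach with
  | refl => exact ⟨.refl, hroot⟩
  | tail _ hstep ih => exact ⟨ih.1.tail ⟨ih.2, hstep⟩, h.child_lt _ ih.2 _ hstep⟩

theorem eq_of_isDescendant (h : IsHACStructure d k children)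
    (hlt : ChildrenPrecede (d + k) children) (hv : v < d + k) (hw : w ∈ children v)
    (hw' : w' ∈ children v) (hww' : IsDescendant (d + k) children w w') : w = w' := by
  rcases hww'.cases_tail with he | ⟨p, hwp, hpw'⟩
  · exact he.symm
  · obtain rfl : p = v := h.parent_unique hpw'.1 hv hpw'.2 hw'
    exact absurd (isDescendant_le hlt hwp) (hlt p hv w hw).not_ge

theorem child_eq_of_isDescendant (h : IsHACStructure d k children)
    (hlt : ChildrenPrecede (d + k) children) (hv : v < d + k) (hw : w ∈ children v)
    (hw' : w' ∈ children v) {i : ℕ} (hwi : IsDescendant (d + k) children w i)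
    (hwi' : IsDescendant (d + k) children w' i) : w = w' := by
  have hunique : Relator.RightUnique (Function.swap fun v w => v < d + k ∧ w ∈ children v) :=
    fun _ _ _ hp hp' => h.parent_unique hp.1 hp'.1 hp.2 hp'.2
  rcases Relation.ReflTransGen.total_of_right_unique hunique hwi.swap hwi'.swap with hr | hr
  · exact (h.eq_of_isDescendant hlt hv hw' hw hr.swap).symm
  · exact h.eq_of_isDescendant hlt hv hw hw' hr.swap

theorem nodeValue_le (h : IsHACStructure d k children) (hlt : ChildrenPrecede (d + k) children)
    (hlab : ∀ v, d ≤ v → v < d + k → IsGenerator (lab v)) (hu : u ∈ Icc (0 : Fin d → ℝ) 1)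
    {i : Fin d} (hvi : IsDescendant (d + k) children v i) :
    nodeValue d children lab u v ≤ u i := by
  induction hvi using Relation.ReflTransGen.head_induction_on with
  | refl => exact (nodeValue_leaf i.2).le
  | @head v w hvw _ ih =>
    have hdv := h.le_of_mem_children hvw.2
    rw [nodeValue_fork hlt hdv hvw.1]
    exact ((hlab v hdv hvw.1).archValue_le hvw.2 (nodeValue_mem_Icc hlt hlab hu
      (h.child_lt v hvw.1 w hvw.2))).trans ih

theorem nodeValue_eq_of_forall_ne_eq_one (h : IsHACStructure d k children)
    (hlt : ChildrenPrecede (d + k) children)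
    (hlab : ∀ v, d ≤ v → v < d + k → IsGenerator (lab v)) {i : Fin d}
    (hui : u i ∈ Icc (0 : ℝ) 1) (hu : ∀ j, j ≠ i → u j = 1)
    (hvi : IsDescendant (d + k) children v i) : nodeValue d children lab u v = u i := by
  induction hvi using Relation.ReflTransGen.head_induction_on with
  | refl => exact nodeValue_leaf i.2
  | @head v w hvw hwi ih =>
    have hdv := h.le_of_mem_children hvw.2
    rw [nodeValue_fork hlt hdv hvw.1, ← ih]
    refine (hlab v hdv hvw.1).archValue_eq_of_forall_ne_eq_one hvw.2 (ih ▸ hui)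
      fun w' hw' hne => ?_
    by_contra hw'1
    exact hne (h.child_eq_of_isDescendant hlt hvw.1 hw' hvw.2 (isDescendant_of_nodeValue_ne_one
      hlt hlab hu (h.child_lt v hvw.1 w' hw') hw'1) hwi)

end IsHACStructure

section HACFunction

variable {d k : ℕ} {children : ℕ → Finset ℕ} {lab : ℕ → ℝ≥0∞ → ℝ}

theorem isNodeValues_nodeValue (hlt : ChildrenPrecede (d + k) children)
    (hlab : ∀ v, d ≤ v → v < d + k → IsGenerator (lab v)) {u : Fin d → ℝ}
    (hu : u ∈ Icc (0 : Fin d → ℝ) 1) :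
    IsNodeValues d k children lab u (nodeValue d children lab u) where
  mem_unit _ hv := nodeValue_mem_Icc hlt hlab hu hv
  fork _ hdv hv := nodeValue_fork hlt hdv hv
  leaf i := nodeValue_leaf i.2

theorem IsNodeValues.eq_nodeValue {u : Fin d → ℝ} {x : ℕ → ℝ}
    (hx : IsNodeValues d k children lab u x) (hlt : ChildrenPrecede (d + k) children) {v : ℕ}
    (hv : v < d + k) : x v = nodeValue d children lab u v := by
  induction v using Nat.strong_induction_on with
  | _ v ih =>
    rcases lt_or_ge v d with hvd | hdv
    · rw [nodeValue_leaf hvd]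
      exact hx.leaf ⟨v, hvd⟩
    · rw [nodeValue_fork hlt hdv hv, hx.fork v hdv hv, archValue, archValue,
        Finset.sum_congr rfl fun w hw => by rw [ih w (hlt v hv w hw) ((hlt v hv w hw).trans hv)]]

theorem IsHACStructure.isHACFunction_nodeValue (h : IsHACStructure d k children)
    (hlt : ChildrenPrecede (d + k) children) (hk : 0 < d + k)
    (hlab : ∀ v, d ≤ v → v < d + k → IsCMGenerator (lab v)) :
    IsHACFunction d k children lab fun u => nodeValue d children lab u (d + k - 1) where
  tree := h
  label := hlab
  exists_values _ hu :=
    ⟨_, isNodeValues_nodeValue hlt (fun v hdv hv => (hlab v hdv hv).1) hu⟩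
  eq_root _ _ _ hx := (hx.eq_nodeValue hlt (Nat.sub_one_lt hk.ne')).symm

theorem IsHACStructure.isCopula_nodeValue (h : IsHACStructure d k children)
    (hlt : ChildrenPrecede (d + k) children) (hk : 0 < k)
    (hlab : IsNestedLabeling d (d + k) children lab) :
    IsCopula fun u => nodeValue d children lab u (d + k - 1) := by
  have hgen : ∀ v, d ≤ v → v < d + k → IsGenerator (lab v) := fun v hdv hv =>
    (hlab.isCMGenerator v hdv hv).1
  have hroot : d + k - 1 < d + k := by omega
  have hreach (i : Fin d) : IsDescendant (d + k) children (d + k - 1) i :=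
    h.isDescendant_root (i.2.trans_le (Nat.le_add_right d k))
  exact {
    grounded := fun u hu ⟨i, hi⟩ => le_antisymm
      ((h.nodeValue_le hlt hgen hu (hreach i)).trans_eq hi)
      (nodeValue_mem_Icc hlt hgen hu hroot).1
    margins := fun u hu i hi => h.nodeValue_eq_of_forall_ne_eq_one hlt hgen
      ⟨hu.1 i, hu.2 i⟩ hi (hreach i)
    increasing := fun a ha b hb hab => boxSum_nonneg_of_continuousOn
      (continuousOn_nodeValue hlt hlab.isCMGenerator hroot)
      (fun a b => nodeValue_boxSum_nonneg_of_pos hlt hlab (by omega) hroot) ha hb hab }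

end HACFunction

/-! Invariants of the structure estimation -/

section BlockAvg

variable {d : ℕ} {T : Matrix (Fin d) (Fin d) ℝ}

theorem blockAvg_comm (hT : T.IsSymm) (A B : Finset (Fin d)) :
    blockAvg T A B = blockAvg T B A := by
  rw [blockAvg, blockAvg, Finset.card_product, Finset.card_product, mul_comm A.card,
    Finset.sum_product, Finset.sum_product_right]
  simp only [hT.apply]

theorem blockAvg_le_iff {A B : Finset (Fin d)} (hA : A.Nonempty) (hB : B.Nonempty) {c : ℝ} :
    blockAvg T A B ≤ c ↔ ∑ p ∈ A ×ˢ B, T p.1 p.2 ≤ c * ((A ×ˢ B).card : ℝ) :=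
  div_le_iff₀ (Nat.cast_pos.2 (hA.product hB).card_pos)

theorem blockAvg_union_le {A A' B : Finset (Fin d)} (hdisj : Disjoint A A') (hA : A.Nonempty)
    (hA' : A'.Nonempty) (hB : B.Nonempty) {c : ℝ} (h : blockAvg T A B ≤ c)
    (h' : blockAvg T A' B ≤ c) : blockAvg T (A ∪ A') B ≤ c := by
  rw [blockAvg_le_iff hA hB] at h
  rw [blockAvg_le_iff hA' hB] at h'
  have hd : Disjoint (A ×ˢ B) (A' ×ˢ B) := Finset.disjoint_product.2 (Or.inl hdisj)
  rw [blockAvg_le_iff (hA.mono Finset.subset_union_left) hB, Finset.union_product,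
    Finset.sum_union hd, Finset.card_union_of_disjoint hd]
  push_cast
  linarith

end BlockAvg

namespace ClusterState

variable {d : ℕ} {T : Matrix (Fin d) (Fin d) ℝ} {s : ClusterState d} {i j f k v w : ℕ}

/-- The edges after `k` passes form a forest with leaves `0, …, d - 1` and forks
`d, …, d + k - 1` whose roots are the active nodes. -/
structure IsForest (k : ℕ) (s : ClusterState d) : Prop where
  active_lt : ∀ v ∈ s.active, v < d + k
  card_active : s.active.card + k = d
  childrenPrecede : ChildrenPrecede (d + k) s.children
  leaf : ∀ v < d, s.children v = ∅
  fork : ∀ v, d ≤ v → v < d + k → 2 ≤ (s.children v).card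
  parent : ∀ w < d + k, w ∉ s.active → ∃! v, v < d + k ∧ w ∈ s.children v
  notMem_children : ∀ w ∈ s.active, ∀ v < d + k, w ∉ s.children v

/-- The active nodes have nonempty and pairwise disjoint sets of descendant leaves. -/
structure IsClustering (s : ClusterState d) : Prop where
  nonempty : ∀ v ∈ s.active, (s.leaves v).Nonempty
  disjoint : (s.active : Set ℕ).Pairwise fun v w => Disjoint (s.leaves v) (s.leaves w)

/-- The estimates at the forks `d, …, d + k - 1` decrease in the order in which the forks were
created, and bound every average that is available for the next join. -/
structure IsMonotone (T : Matrix (Fin d) (Fin d) ℝ) (k : ℕ) (s : ClusterState d) : Prop where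
  antitoneOn_tauHat : AntitoneOn s.tauHat (Ico d (d + k))
  blockAvg_le : ∀ f ∈ Ico d (d + k), (s.active : Set ℕ).Pairwise fun v w =>
    blockAvg T (s.leaves v) (s.leaves w) ≤ s.tauHat f

theorem mem_active_join :
    v ∈ (s.join T i j f).active ↔ (v = f ∨ v ∈ s.active) ∧ v ≠ i ∧ v ≠ j := by
  simp [join]

theorem card_active_join (hi : i ∈ s.active) (hj : j ∈ s.active) (hij : i ≠ j)
    (hf : f ∉ s.active) : (s.join T i j f).active.card + 1 = s.active.card := by
  have hsub : {i, j} ⊆ insert f s.active := Finset.insert_subset_iff.2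
    ⟨Finset.mem_insert_of_mem hi, Finset.singleton_subset_iff.2 (Finset.mem_insert_of_mem hj)⟩
  have hcard := Finset.card_sdiff_add_card_eq_card hsub
  rw [Finset.card_pair hij, Finset.card_insert_of_notMem hf] at hcard
  exact Nat.succ.inj hcard

theorem children_join_self : (s.join T i j f).children f = {i, j} :=
  Function.update_self ..

theorem children_join_of_ne (hv : v ≠ f) : (s.join T i j f).children v = s.children v :=
  Function.update_of_ne hv ..

theorem leaves_join_self : (s.join T i j f).leaves f = s.leaves i ∪ s.leaves j :=
  Function.update_self ..

theorem leaves_join_of_ne (hv : v ≠ f) : (s.join T i j f).leaves v = s.leaves v :=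
  Function.update_of_ne hv ..

theorem tauHat_join_self :
    (s.join T i j f).tauHat f = blockAvg T (s.leaves i) (s.leaves j) :=
  Function.update_self ..

theorem tauHat_join_of_ne (hv : v ≠ f) : (s.join T i j f).tauHat v = s.tauHat v :=
  Function.update_of_ne hv ..

theorem pairwise_leaves_join {R : Finset (Fin d) → Finset (Fin d) → Prop}
    (hR : ∀ A B, R A B → R B A)
    (hs : (s.active : Set ℕ).Pairwise fun v w => R (s.leaves v) (s.leaves w))
    (hunion : ∀ w ∈ s.active, w ≠ i → w ≠ j → R (s.leaves i ∪ s.leaves j) (s.leaves w)) :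
    ((s.join T i j f).active : Set ℕ).Pairwise fun v w =>
      R ((s.join T i j f).leaves v) ((s.join T i j f).leaves w) := by
  have hnew : ∀ w ∈ (s.join T i j f).active, w ≠ f →
      R ((s.join T i j f).leaves f) ((s.join T i j f).leaves w) := fun w hw hwf => by
    obtain ⟨hw, hwi, hwj⟩ := mem_active_join.1 hw
    rw [leaves_join_self, leaves_join_of_ne hwf]
    exact hunion w (hw.resolve_left hwf) hwi hwj
  intro v hv w hw hvw
  rcases eq_or_ne v f with rfl | hvf
  · exact hnew w hw hvw.symm
  · rcases eq_or_ne w f with rfl | hwf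
    · exact hR _ _ (hnew v hv hvf)
    · simp only [leaves_join_of_ne hvf, leaves_join_of_ne hwf]
      exact hs ((mem_active_join.1 hv).1.resolve_left hvf)
        ((mem_active_join.1 hw).1.resolve_left hwf) hvw

theorem isClustering_init : (init d).IsClustering where
  nonempty v hv := ⟨⟨v, Finset.mem_range.1 hv⟩, by simp [init]⟩
  disjoint v _ w _ hvw := Finset.disjoint_left.2 fun l hl hl' =>
    hvw ((Finset.mem_filter.1 hl).2.symm.trans (Finset.mem_filter.1 hl').2)

theorem IsClustering.join (hs : s.IsClustering) (hi : i ∈ s.active) (hj : j ∈ s.active) :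
    (s.join T i j f).IsClustering where
  nonempty v hv := by
    rcases eq_or_ne v f with rfl | hvf
    · rw [leaves_join_self]
      exact (hs.nonempty i hi).mono Finset.subset_union_left
    · rw [leaves_join_of_ne hvf]
      exact hs.nonempty v ((mem_active_join.1 hv).1.resolve_left hvf)
  disjoint := pairwise_leaves_join (fun _ _ h => h.symm) hs.disjoint fun _ hw hwi hwj =>
    Finset.disjoint_union_left.2 ⟨hs.disjoint hi hw hwi.symm, hs.disjoint hj hw hwj.symm⟩

theorem IsArgmax.pairwise_blockAvg_le (hij : s.IsArgmax T i j) (hT : T.IsSymm) :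
    (s.active : Set ℕ).Pairwise fun v w =>
      blockAvg T (s.leaves v) (s.leaves w) ≤ blockAvg T (s.leaves i) (s.leaves j) := by
  intro v hv w hw hvw
  rcases hvw.lt_or_gt with h | h
  · exact hij.2.2.2 v hv w hw h
  · exact (blockAvg_comm hT _ _).trans_le (hij.2.2.2 w hw v hv h)

theorem IsArgmax.pairwise_blockAvg_join_le (hij : s.IsArgmax T i j) (hT : T.IsSymm)
    (hs : s.IsClustering) :
    ((s.join T i j f).active : Set ℕ).Pairwise fun v w =>
      blockAvg T ((s.join T i j f).leaves v) ((s.join T i j f).leaves w) ≤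
        blockAvg T (s.leaves i) (s.leaves j) := by
  obtain ⟨hi, hj, hlt, -⟩ := id hij
  have hmax := hij.pairwise_blockAvg_le hT
  refine pairwise_leaves_join (R := fun A B => blockAvg T A B ≤ _)
    (fun A B h => (blockAvg_comm hT B A).trans_le h) hmax fun w hw hwi hwj => ?_
  exact blockAvg_union_le (hs.disjoint hi hj hlt.ne) (hs.nonempty i hi) (hs.nonempty j hj)
    (hs.nonempty w hw) (hmax hi hw hwi.symm) (hmax hj hw hwj.symm)

theorem isMonotone_init : (init d).IsMonotone T 0 where
  antitoneOn_tauHat _ _ _ _ _ := le_rfl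
  blockAvg_le _ hf := absurd hf.2 hf.1.not_gt

theorem IsMonotone.join (hs : s.IsMonotone T k) (hT : T.IsSymm) (hclust : s.IsClustering)
    (hij : s.IsArgmax T i j) : (s.join T i j (d + k)).IsMonotone T (k + 1) := by
  have hmax_le : ∀ f ∈ Ico d (d + (k + 1)),
      blockAvg T (s.leaves i) (s.leaves j) ≤ (s.join T i j (d + k)).tauHat f := fun f hf => by
    rcases (show f ≤ d + k from Nat.lt_succ_iff.1 hf.2).eq_or_lt with rfl | hfk
    · rw [tauHat_join_self]
    · rw [tauHat_join_of_ne hfk.ne]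
      exact hs.blockAvg_le f ⟨hf.1, hfk⟩ hij.1 hij.2.1 hij.2.2.1.ne
  refine ⟨fun f hf g hg hfg => ?_, fun f hf v hv w hw hvw =>
    (hij.pairwise_blockAvg_join_le hT hclust hv hw hvw).trans (hmax_le f hf)⟩
  rcases (show g ≤ d + k from Nat.lt_succ_iff.1 hg.2).eq_or_lt with rfl | hgk
  · rw [tauHat_join_self]
    exact hmax_le f hf
  · have hfk := hfg.trans_lt hgk
    rw [tauHat_join_of_ne hfk.ne, tauHat_join_of_ne hgk.ne]
    exact hs.antitoneOn_tauHat ⟨hf.1, hfk⟩ ⟨hg.1, hgk⟩ hfg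

theorem isForest_init : (init d).IsForest 0 where
  active_lt _ hv := Finset.mem_range.1 hv
  card_active := Finset.card_range d
  childrenPrecede _ _ _ hw := absurd hw (Finset.notMem_empty _)
  leaf _ _ := rfl
  fork _ hdv hv := absurd hv hdv.not_gt
  parent _ hw hnot := absurd (Finset.mem_range.2 hw) hnot
  notMem_children _ _ _ _ := Finset.notMem_empty _

theorem IsForest.existsUnique_parent_join (hs : s.IsForest k) (hi : i ∈ s.active)
    (hj : j ∈ s.active) (hw : w < d + (k + 1)) (hwa : w ∉ (s.join T i j (d + k)).active) :
    ∃! v, v < d + (k + 1) ∧ w ∈ (s.join T i j (d + k)).children v := by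
  have hid := hs.active_lt i hi
  have hjd := hs.active_lt j hj
  by_cases hwij : w = i ∨ w = j
  · have hws : w ∈ s.active := by rcases hwij with rfl | rfl <;> assumption
    refine ⟨d + k, ⟨by omega, ?_⟩, fun v ⟨hv, hwv⟩ => ?_⟩
    · rwa [children_join_self, Finset.mem_insert, Finset.mem_singleton]
    · by_contra hvk
      rw [children_join_of_ne hvk] at hwv
      exact hs.notMem_children w hws v ((Nat.le_of_lt_succ hv).lt_of_ne hvk) hwv
  · rw [mem_active_join, ← not_or, not_and_not_right] at hwa
    have hws : ¬(w = d + k ∨ w ∈ s.active) := fun h => hwij (hwa h)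
    obtain ⟨p, ⟨hp, hwp⟩, hunique⟩ := hs.parent w (by omega) fun h => hws (.inr h)
    refine ⟨p, ⟨by omega, by rwa [children_join_of_ne hp.ne]⟩, fun v ⟨hv, hwv⟩ => ?_⟩
    rcases eq_or_ne v (d + k) with rfl | hvk
    · rw [children_join_self, Finset.mem_insert, Finset.mem_singleton] at hwv
      exact absurd hwv hwij
    · rw [children_join_of_ne hvk] at hwv
      exact hunique v ⟨by omega, hwv⟩

theorem IsForest.notMem_children_join (hs : s.IsForest k)
    (hwa : w ∈ (s.join T i j (d + k)).active) (hv : v < d + (k + 1)) :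
    w ∉ (s.join T i j (d + k)).children v := by
  obtain ⟨hw, hwi, hwj⟩ := mem_active_join.1 hwa
  rcases eq_or_ne v (d + k) with rfl | hvk
  · rw [children_join_self, Finset.mem_insert, Finset.mem_singleton]
    exact not_or.2 ⟨hwi, hwj⟩
  · rw [children_join_of_ne hvk]
    have hv' : v < d + k := by omega
    rcases hw with rfl | hw
    · exact fun hwv => (hs.childrenPrecede v hv' _ hwv).not_gt hv'
    · exact hs.notMem_children w hw v hv'

theorem IsForest.join (hs : s.IsForest k) (hi : i ∈ s.active) (hj : j ∈ s.active) (hij : i ≠ j) :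
    (s.join T i j (d + k)).IsForest (k + 1) := by
  have hid := hs.active_lt i hi
  have hjd := hs.active_lt j hj
  refine ⟨fun v hv => ?_, ?_, fun v hv w hw => ?_, fun v hv => ?_, fun v hdv hv => ?_,
    fun _ => hs.existsUnique_parent_join hi hj, fun _ hw _ => hs.notMem_children_join hw⟩
  · rcases (mem_active_join.1 hv).1 with rfl | hv
    exacts [by omega, (hs.active_lt v hv).trans (by omega)]
  · have := card_active_join (T := T) hi hj hij fun h => (hs.active_lt (d + k) h).false
    have := hs.card_active
    omega
  · rcases eq_or_ne v (d + k) with rfl | hvk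
    · rw [children_join_self, Finset.mem_insert, Finset.mem_singleton] at hw
      omega
    · rw [children_join_of_ne hvk] at hw
      exact hs.childrenPrecede v (by omega) w hw
  · rw [children_join_of_ne (by omega), hs.leaf v hv]
  · rcases eq_or_ne v (d + k) with rfl | hvk
    · rw [children_join_self, Finset.card_pair hij]
    · rw [children_join_of_ne hvk]
      exact hs.fork v hdv (by omega)

theorem IsForest.isHACStructure (hs : s.IsForest k) (hcard : s.active.card = 1) :
    IsHACStructure d k s.children := by
  obtain ⟨r, hr⟩ := Finset.card_eq_one.1 hcard
  have hrlt := hs.active_lt r (hr ▸ Finset.mem_singleton_self r)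
  have hroot : d + k - 1 ∈ s.active := by
    by_contra hnot
    obtain ⟨v, ⟨hv, hwv⟩, -⟩ := hs.parent _ (by omega) hnot
    have := hs.childrenPrecede v hv _ hwv
    omega
  have hparent : ∀ w < d + k - 1, ∃! v, v < d + k ∧ w ∈ s.children v :=
    fun w hw => hs.parent w (by omega) fun hwa =>
      hw.ne (Finset.card_le_one.1 hcard.le w hwa _ hroot)
  refine ⟨fun v hv w hw => (hs.childrenPrecede v hv w hw).trans hv, hs.leaf, hs.fork,
    fun v hv => hs.notMem_children _ hroot v hv, hparent, fun w hw => ?_⟩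
  induction hn : d + k - w using Nat.strong_induction_on generalizing w with
  | _ n ih =>
    rcases eq_or_ne w (d + k - 1) with rfl | hwr
    · exact .refl
    · obtain ⟨v, ⟨hv, hwv⟩, -⟩ := hparent w (by omega)
      have := hs.childrenPrecede v hv w hwv
      exact (ih _ (by omega) v hv rfl).tail hwv

end ClusterState

namespace StructureRun

variable {d k : ℕ} {T : Matrix (Fin d) (Fin d) ℝ} {s : ClusterState d}

theorem isForest (h : StructureRun T k s) : s.IsForest k := by
  induction h with
  | init => exact ClusterState.isForest_init
  | step k s i j _ hij ih => exact ih.join hij.1 hij.2.1 hij.2.2.1.ne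

theorem isClustering (h : StructureRun T k s) : s.IsClustering := by
  induction h with
  | init => exact ClusterState.isClustering_init
  | step k s i j _ hij ih => exact ih.join hij.1 hij.2.1

theorem isMonotone (h : StructureRun T k s) (hT : T.IsSymm) : s.IsMonotone T k := by
  induction h with
  | init => exact ClusterState.isMonotone_init
  | step k s i j hs hij ih => exact ih.join hT hs.isClustering hij

end StructureRun

theorem IsStructureEstimate.isHACStructure {d : ℕ} {T : Matrix (Fin d) (Fin d) ℝ}
    {s : ClusterState d} (h : IsStructureEstimate T s) (hd : 0 < d) :
    IsHACStructure d (d - 1) s.children := by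
  have hs : s.IsForest (d - 1) := StructureRun.isForest h
  have hcard := hs.card_active
  exact hs.isHACStructure (by omega)

theorem monotoneOn_invFunOn_image {α β : Type*} [LinearOrder α] [Nonempty α] [LinearOrder β]
    {f : α → β} {s : Set α} (hf : MonotoneOn f s) :
    MonotoneOn (Function.invFunOn f s) (f '' s) := by
  intro a ha b hb hab
  by_contra! hlt
  have hba := hf (Function.invFunOn_mem hb) (Function.invFunOn_mem ha) hlt.le
  rw [Function.invFunOn_eq ha, Function.invFunOn_eq hb] at hba
  exact hlt.ne (congrArg _ (hba.antisymm hab))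

theorem antitoneOn_thetaHat {F : ArchFamily} {τa : ℝ → ℝ} {tauHat : ℕ → ℝ} {I : Set ℕ}
    (h_mono : MonotoneOn τa F.Θ) (h_tauHat : AntitoneOn tauHat I)
    (h_range : ∀ v ∈ I, tauHat v ∈ τa '' F.Θ) : AntitoneOn (thetaHat F τa tauHat) I :=
  fun _ hv _ hw hvw => monotoneOn_invFunOn_image h_mono (h_range _ hw) (h_range _ hv)
    (h_tauHat hv hw hvw)

theorem isNestedLabeling_labelHat {F : ArchFamily} {τa : ℝ → ℝ} {tauHat : ℕ → ℝ} {d n : ℕ}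
    {children : ℕ → Finset ℕ} (hlt : ChildrenPrecede n children)
    (h_nest : ∀ θ₁ ∈ F.Θ, ∀ θ₂ ∈ F.Θ, θ₁ ≤ θ₂ → SufficientNesting (F.gen θ₁) (F.gen θ₂))
    (h_anti : AntitoneOn (thetaHat F τa tauHat) (Ico d n))
    (h_range : ∀ v ∈ Ico d n, tauHat v ∈ τa '' F.Θ) :
    IsNestedLabeling d n children (labelHat F τa tauHat) := by
  have hmem : ∀ v ∈ Ico d n, thetaHat F τa tauHat v ∈ F.Θ := fun v hv =>
    Function.invFunOn_mem (h_range v hv)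
  refine ⟨fun v hdv hv => F.isCMGenerator _ (hmem v ⟨hdv, hv⟩), fun v hdv hv w hw hdw => ?_⟩
  have hwv := hlt v hv w hw
  have hw_mem : w ∈ Ico d n := ⟨hdw, hwv.trans hv⟩
  exact h_nest _ (hmem v ⟨hdv, hv⟩) _ (hmem w hw_mem) (h_anti hw_mem ⟨hdv, hv⟩ hwv.le)

theorem mainTheorem4 (F : ArchFamily) (τa : ℝ → ℝ)
    (h_tau : ∀ θ ∈ F.Θ, τa θ = kendallTau (archCopula 2 (F.gen θ)))
    (h_mono : StrictMonoOn τa F.Θ)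
    (h_nest : ∀ θ₁ ∈ F.Θ, ∀ θ₂ ∈ F.Θ,
      SufficientNesting (F.gen θ₁) (F.gen θ₂) ↔ θ₁ ≤ θ₂)
    (d : ℕ) (hd : 2 ≤ d) (T : Matrix (Fin d) (Fin d) ℝ) (hT : T.IsSymm)
    (est : ClusterState d) (h_est : IsStructureEstimate T est)
    (h_range : ∀ v, d ≤ v → v < d + (d - 1) → est.tauHat v ∈ τa '' F.Θ) :
    (∀ v, d ≤ v → v < d + (d - 1) → ∀ w ∈ est.children v, d ≤ w → w < d + (d - 1) →
      thetaHat F τa est.tauHat v ≤ thetaHat F τa est.tauHat w) ∧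
    ∃ C : (Fin d → ℝ) → ℝ,
      IsHACFunction d (d - 1) est.children (labelHat F τa est.tauHat) C ∧ IsCopula C := by
  have hrun : StructureRun T (d - 1) est := h_est
  have hlt := hrun.isForest.childrenPrecede
  have htree := h_est.isHACStructure (by omega)
  have hrange : ∀ v ∈ Ico d (d + (d - 1)), est.tauHat v ∈ τa '' F.Θ :=
    fun v hv => h_range v hv.1 hv.2
  have htheta : AntitoneOn (thetaHat F τa est.tauHat) (Ico d (d + (d - 1))) :=
    antitoneOn_thetaHat h_mono.monotoneOn (hrun.isMonotone hT).antitoneOn_tauHat hrange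
  have hlab := isNestedLabeling_labelHat hlt (fun θ₁ h₁ θ₂ h₂ => (h_nest θ₁ h₁ θ₂ h₂).2) htheta
    hrange
  refine ⟨fun v hdv hv w hw hdw hwn => htheta ⟨hdw, hwn⟩ ⟨hdv, hv⟩ (hlt v hv w hw).le,
    fun u => nodeValue d est.children (labelHat F τa est.tauHat) u (d + (d - 1) - 1),
    htree.isHACFunction_nodeValue hlt (by omega) hlab.isCMGenerator,
    htree.isCopula_nodeValue hlt (by omega) hlab⟩
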